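/- Let $p$ be a prime number, let $k$ be a field of characteristic $p$, and let $G$ be a locally profinite group (a locally compact, Hausdorff, totally disconnected topological group). Assume that $G$ contains an open pro-$p$ subgroup, and that $G$ contains no proper open centralisers: if the centraliser $C_G(g)$ of an element $g\in G$ is open in $G$, then $C_G(g)=G$. For a locally profinite group $H$ let $\mathrm{Mod}(H)$ be the category of smooth $k$-linear representations of $H$ (those in which every vector is fixed by an open subgroup), and let $\mathfrak{Z}(H)$ be the Bernstein center of $H$, i.e. the $k$-algebra of natural endomorphisms of the identity functor on $\mathrm{Mod}(H)$. Let $Z=Z(G)$ be the center of $G$ with the subspace topology, which is again a locally profinite group, and put $$\widehat{k[Z]} := \varprojlim_{Z'} k[Z/Z'],$$ where $Z'$ runs over all compact open subgroups of $Z$. Let $H$ be either $G$ or $Z$. The algebra $\widehat{k[Z]}$ acts on every $V\in\mathrm{Mod}(H)$: if a vector $v\in V$ is fixed by a compact open subgroup $Z'$ of $Z$, then $a\in\widehat{k[Z]}$ sends $v$ to $a_{Z'}\cdot v$, where $a_{Z'}\in k[Z/Z']$ is the component of $a$ and $Z/Z'$ acts on the $Z'$-fixed vectors $V^{Z'}$;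 this does not depend on the choice of $Z'$. The action is natural in $V$ and commutes with $H$, and so it defines $k$-algebra homomorphisms $$\Phi_G:\widehat{k[Z]}\to\mathfrak{Z}(G),\qquad \Phi_Z:\widehat{k[Z]}\to\mathfrak{Z}(Z).$$ Then $\Phi_Z$ is an isomorphism, and the composed map $$\Phi_G\circ\Phi_Z^{-1}:\ \mathfrak{Z}(Z(G))\longrightarrow\mathfrak{Z}(G)$$ is an isomorphism of $k$-algebras. -/

import Mathlib

open CategoryTheory

universe w u v

/-- A locally profinite group: a locally compact, Hausdorff, totally disconnected
topological group. -/
class IsLocallyProfinite (G : Type*) [Group G] [TopologicalSpace G] : Prop extends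
  IsTopologicalGroup G, T2Space G, LocallyCompactSpace G, TotallyDisconnectedSpace G

/-- The compact open subgroups of a topological group, ordered by inclusion. -/
abbrev CompactOpenSubgroup (G : Type*) [Group G] [TopologicalSpace G] : Type _ :=
  {H : Subgroup G // IsOpen (H : Set G) ∧ IsCompact (H : Set G)}

/-- Every neighbourhood of `1` in a locally profinite group contains a compact open subgroup. -/
theorem IsLocallyProfinite.exists_compactOpenSubgroup {G : Type*} [Group G] [TopologicalSpace G]
    [IsLocallyProfinite G] {U : Set G} (hU : U ∈ nhds (1 : G)) :
    ∃ H : CompactOpenSubgroup G, (H.1 : Set G) ⊆ U := by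
  obtain ⟨K, hKc, hK1, hKU⟩ := exists_compact_subset isOpen_interior (mem_interior_iff_mem_nhds.2 hU)
  obtain ⟨W, hW, hW1, hWK⟩ :=
    (loc_compact_Haus_tot_disc_of_zero_dim (H := G)).exists_subset_of_mem_open hK1 isOpen_interior
  have hWc : IsCompact W := hKc.of_isClosed_subset hW.1 (hWK.trans interior_subset)
  obtain ⟨V, hV, hVW⟩ := compact_open_separated_mul_right hWc hW.2 subset_rfl
  have hWV : ∀ x ∈ W, ∀ y ∈ V, x * y ∈ W := fun x hx y hy => hVW (Set.mul_mem_mul hx hy)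
  set H : Subgroup G := Subgroup.closure (V ∩ V⁻¹) with hH
  have hHo : IsOpen (H : Set G) := Subgroup.isOpen_of_mem_nhds H
    (Filter.mem_of_superset (Filter.inter_mem hV (inv_mem_nhds_one G hV)) Subgroup.subset_closure)
  have hstep : ∀ y ∈ H, ∀ x ∈ W, x * y ∈ W := by
    intro y hy
    induction hy using Subgroup.closure_induction'' with
    | mem y hy => exact fun x hx => hWV x hx y hy.1
    | inv_mem y hy => exact fun x hx => hWV x hx _ hy.2
    | one => simp
    | mul y z _ _ ihy ihz => exact fun x hx => mul_assoc x y z ▸ ihz _ (ihy _ hx)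
  have hHW : (H : Set G) ⊆ W := fun y hy => by simpa using hstep y hy 1 hW1
  exact ⟨⟨H, hHo, hWc.of_isClosed_subset (Subgroup.isClosed_of_isOpen H hHo) hHW⟩,
    fun y hy => interior_subset (hKU (interior_subset (hWK (hHW hy))))⟩

/-- The center of a locally profinite group, with the subspace topology, is locally profinite. -/
instance IsLocallyProfinite.center (G : Type*) [Group G] [TopologicalSpace G]
    [IsLocallyProfinite G] : IsLocallyProfinite (Subgroup.center G) := by
  have hc : IsClosed (Subgroup.center G : Set G) := by
    have : (Subgroup.center G : Set G) = ⋂ g : G, {z | g * z = z * g} := by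
      ext z; simp [Subgroup.mem_center_iff]
    rw [this]
    exact isClosed_iInter fun g => isClosed_eq (by fun_prop) (by fun_prop)
  have := hc.isClosedEmbedding_subtypeVal.locallyCompactSpace
  exact { }

/-- A pro-`p` group: a profinite group all of whose continuous finite quotients
are `p`-groups. -/
structure IsProP (p : ℕ) (U : Type*) [Group U] [TopologicalSpace U] : Prop extends
    IsTopologicalGroup U, CompactSpace U, T2Space U, TotallyDisconnectedSpace U where
  isPGroup_quotient : ∀ (N : Subgroup U) [N.Normal], IsOpen (N : Set U) → IsPGroup p (U ⧸ N)

/-- A group is locally pro-`p` if it contains an open pro-`p` subgroup. -/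
def IsLocallyProP (p : ℕ) (G : Type*) [Group G] [TopologicalSpace G] : Prop :=
  ∃ U : Subgroup G, IsOpen (U : Set G) ∧ IsProP p U

/-- The only open centraliser of an element of `G` is `G` itself. -/
def NoProperOpenCentralizer (G : Type*) [Group G] [TopologicalSpace G] : Prop :=
  ∀ g : G, IsOpen (Subgroup.centralizer {g} : Set G) → Subgroup.centralizer {g} = ⊤

section SmoothRepresentations


/-- A representation is smooth if every vector is fixed by an open subgroup. -/
def Representation.IsSmooth {k G V : Type*} [CommSemiring k] [Group G] [TopologicalSpace G]
    [AddCommMonoid V] [Module k V] (ρ : Representation k G V) : Prop :=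
  ∀ x : V, ∃ H : Subgroup G, IsOpen (H : Set G) ∧ ∀ h ∈ H, ρ h x = x

/-- The category `Mod(G)` of smooth `k`-linear representations of `G` on vector spaces in
`Type w`: the full subcategory of the category of all representations. -/
abbrev SmoothRep (k : Type u) (G : Type v) [Field k] [Group G] [TopologicalSpace G] :=
  ObjectProperty.FullSubcategory (fun V : Rep.{w} k G => V.ρ.IsSmooth)

/-- The Bernstein center of `G`: the natural endomorphisms of the identity functor of `Mod(G)`.
It is a `k`-algebra because `Mod(G)` is a `k`-linear category. -/
abbrev BernsteinCenter (k : Type u) (G : Type v) [Field k] [Group G] [TopologicalSpace G] :=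
  CatCenter (SmoothRep.{w} k G)

end SmoothRepresentations

section Completion

variable (k : Type*) [Field k] {Z : Type*} [Group Z] [IsMulCommutative Z]

/-- The canonical map `k[Z/H] → k[Z/K]` for subgroups `H ≤ K`. -/
noncomputable def groupAlgebraTransition {H K : Subgroup Z} (h : H ≤ K) :
    MonoidAlgebra k (Z ⧸ H) →ₐ[k] MonoidAlgebra k (Z ⧸ K) :=
  MonoidAlgebra.mapDomainAlgHom k k (QuotientGroup.map H K (MonoidHom.id Z) h)

variable (Z) in
/-- The inverse limit of the group algebras `k[Z/H]`, where `H` runs over the compact open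
subgroups of `Z`. -/
noncomputable def CompletedGroupAlgebra [TopologicalSpace Z] :
    Subalgebra k (∀ H : CompactOpenSubgroup Z, MonoidAlgebra k (Z ⧸ H.1)) where
  carrier := {x | ∀ (H K : CompactOpenSubgroup Z) (h : H ≤ K),
    groupAlgebraTransition k (show H.1 ≤ K.1 from h) (x H) = x K}
  mul_mem' hx hy H K h := by simp [hx H K h, hy H K h]
  add_mem' hx hy H K h := by simp [hx H K h, hy H K h]
  algebraMap_mem' r H K h := by simp [-MonoidAlgebra.coe_algebraMap]

end Completion

namespace CompletedGroupAlgebra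

section Action

theorem exists_level {k Z V : Type*} [Field k] [Group Z] [AddCommGroup V] [Module k V]
    [TopologicalSpace Z] [IsLocallyProfinite Z] (ρ : Representation k Z V) (hρ : ρ.IsSmooth)
    (x : V) :
    ∃ H : CompactOpenSubgroup Z, x ∈ Representation.invariants (ρ.comp H.1.subtype) := by
  obtain ⟨U, hU, hx⟩ := hρ x
  obtain ⟨H, hH⟩ := IsLocallyProfinite.exists_compactOpenSubgroup (hU.mem_nhds U.one_mem)
  exact ⟨H, fun h => hx _ (hH h.2)⟩

variable {k Z V W : Type*} [Field k] [Group Z] [IsMulCommutative Z] [AddCommGroup V] [Module k V]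
  [AddCommGroup W] [Module k W]

/-- The action of `k[Z/H]` on the subspace `V^H` of `H`-fixed vectors. -/
noncomputable def levelAction (ρ : Representation k Z V) (H : Subgroup Z) :
    MonoidAlgebra k (Z ⧸ H) →ₐ[k] Module.End k (Representation.invariants (ρ.comp H.subtype)) :=
  (ρ.quotientToInvariants H).asAlgebraHom

theorem levelAction_intertwining (ρ : Representation k Z V) (σ : Representation k Z W)
    (f : V →ₗ[k] W) (hf : ∀ z x, f (ρ z x) = σ z (f x)) (H : Subgroup Z)
    (a : MonoidAlgebra k (Z ⧸ H)) (x : Representation.invariants (ρ.comp H.subtype))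
    (y : Representation.invariants (σ.comp H.subtype)) (hxy : f x = y) :
    f (levelAction ρ H a x) = levelAction σ H a y := by
  induction a using MonoidAlgebra.induction_linear with
  | zero => simp
  | add a b ha hb => simp [ha, hb]
  | single q r =>
    induction q using QuotientGroup.induction_on with
    | H z =>
      simp only [levelAction, Representation.asAlgebraHom_single, LinearMap.smul_apply,
        Submodule.coe_smul, map_smul]
      congr 1
      change f (ρ z x) = σ z y
      rw [hf, hxy]

theorem levelAction_transition (ρ : Representation k Z V) {H K : Subgroup Z} (h : H ≤ K)
    (a : MonoidAlgebra k (Z ⧸ H)) (x : Representation.invariants (ρ.comp H.subtype))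
    (y : Representation.invariants (ρ.comp K.subtype)) (hxy : (x : V) = y) :
    (levelAction ρ K (groupAlgebraTransition k h a) y : V) = levelAction ρ H a x := by
  induction a using MonoidAlgebra.induction_linear with
  | zero => simp
  | add a b ha hb => simp [ha, hb]
  | single q r =>
    induction q using QuotientGroup.induction_on with
    | H z =>
      simp only [levelAction, groupAlgebraTransition, MonoidAlgebra.mapDomainAlgHom_apply,
        MonoidAlgebra.mapDomain_single, Representation.asAlgebraHom_single, LinearMap.smul_apply,
        Submodule.coe_smul]
      congr 1
      change ρ z y = ρ z x
      rw [hxy]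

variable [TopologicalSpace Z] [IsLocallyProfinite Z]

/-- The action of an element `a` of the completed group algebra on a vector `x` of a smooth
representation: choose a compact open subgroup `H` fixing `x`, and let the component of `a`
in `k[Z/H]` act on `x`. -/
noncomputable def act (ρ : Representation k Z V) (hρ : ρ.IsSmooth)
    (a : CompletedGroupAlgebra k Z) (x : V) : V :=
  levelAction ρ (exists_level ρ hρ x).choose.1 (a.1 (exists_level ρ hρ x).choose)
    ⟨x, (exists_level ρ hρ x).choose_spec⟩

/-- The action does not depend on the chosen compact open subgroup. -/
theorem act_eq (ρ : Representation k Z V) (hρ : ρ.IsSmooth) (a : CompletedGroupAlgebra k Z)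
    (H : CompactOpenSubgroup Z) (x : Representation.invariants (ρ.comp H.1.subtype)) :
    act ρ hρ a x = levelAction ρ H.1 (a.1 H) x := by
  obtain ⟨x, hx⟩ := x
  set K := (exists_level ρ hρ x).choose with hK
  have hxK := (exists_level ρ hρ x).choose_spec
  let L : CompactOpenSubgroup Z :=
    ⟨H.1 ⊓ K.1, H.2.1.inter K.2.1, H.2.2.inter_right (Subgroup.isClosed_of_isOpen _ K.2.1)⟩
  have hLH : L ≤ H := (inf_le_left : H.1 ⊓ K.1 ≤ H.1)
  have hLK : L ≤ K := (inf_le_right : H.1 ⊓ K.1 ≤ K.1)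
  have hxL : x ∈ Representation.invariants (ρ.comp L.1.subtype) := fun h => hx ⟨h.1, hLH h.2⟩
  have h1 := levelAction_transition ρ hLH (a.1 L) ⟨x, hxL⟩ ⟨x, hx⟩ rfl
  have h2 := levelAction_transition ρ hLK (a.1 L) ⟨x, hxL⟩ ⟨x, hxK⟩ rfl
  rw [a.2 L H hLH] at h1
  rw [a.2 L K hLK] at h2
  exact h2.trans h1.symm

theorem act_intertwining (ρ : Representation k Z V) (hρ : ρ.IsSmooth)
    (σ : Representation k Z W) (hσ : σ.IsSmooth)
    (f : V →ₗ[k] W) (hf : ∀ z x, f (ρ z x) = σ z (f x)) (a : CompletedGroupAlgebra k Z) (x : V) :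
    f (act ρ hρ a x) = act σ hσ a (f x) := by
  obtain ⟨H, hx⟩ := exists_level ρ hρ x
  have hfx : f x ∈ Representation.invariants (σ.comp H.1.subtype) := fun h => by
    have := hx h
    simp only [MonoidHom.comp_apply] at this ⊢
    rw [← hf, this]
  rw [act_eq ρ hρ a H ⟨x, hx⟩, act_eq σ hσ a H ⟨f x, hfx⟩]
  exact levelAction_intertwining ρ σ f hf H.1 _ _ _ rfl

theorem act_vadd (ρ : Representation k Z V) (hρ : ρ.IsSmooth) (a : CompletedGroupAlgebra k Z)
    (x y : V) : act ρ hρ a (x + y) = act ρ hρ a x + act ρ hρ a y := by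
  obtain ⟨H, hx⟩ := exists_level ρ hρ x
  obtain ⟨K, hy⟩ := exists_level ρ hρ y
  let L : CompactOpenSubgroup Z :=
    ⟨H.1 ⊓ K.1, H.2.1.inter K.2.1, H.2.2.inter_right (Subgroup.isClosed_of_isOpen _ K.2.1)⟩
  have hxL : x ∈ Representation.invariants (ρ.comp L.1.subtype) := fun h => hx ⟨h.1, h.2.1⟩
  have hyL : y ∈ Representation.invariants (ρ.comp L.1.subtype) := fun h => hy ⟨h.1, h.2.2⟩
  have h : (⟨x + y, add_mem hxL hyL⟩ : Representation.invariants (ρ.comp L.1.subtype)) =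
    ⟨x, hxL⟩ + ⟨y, hyL⟩ := rfl
  rw [act_eq ρ hρ a L ⟨x, hxL⟩, act_eq ρ hρ a L ⟨y, hyL⟩,
    act_eq ρ hρ a L ⟨x + y, add_mem hxL hyL⟩, h, map_add, Submodule.coe_add]

theorem act_vsmul (ρ : Representation k Z V) (hρ : ρ.IsSmooth) (a : CompletedGroupAlgebra k Z)
    (r : k) (x : V) : act ρ hρ a (r • x) = r • act ρ hρ a x := by
  obtain ⟨H, hx⟩ := exists_level ρ hρ x
  have h : (⟨r • x, Submodule.smul_mem _ r hx⟩ :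
    Representation.invariants (ρ.comp H.1.subtype)) = r • ⟨x, hx⟩ := rfl
  rw [act_eq ρ hρ a H ⟨x, hx⟩, act_eq ρ hρ a H ⟨r • x, Submodule.smul_mem _ r hx⟩, h, map_smul,
    Submodule.coe_smul]

theorem act_add (ρ : Representation k Z V) (hρ : ρ.IsSmooth) (a b : CompletedGroupAlgebra k Z)
    (x : V) : act ρ hρ (a + b) x = act ρ hρ a x + act ρ hρ b x := by
  obtain ⟨H, hx⟩ := exists_level ρ hρ x
  have h : (a + b).1 H = a.1 H + b.1 H := rfl
  rw [act_eq ρ hρ (a + b) H ⟨x, hx⟩, act_eq ρ hρ b H ⟨x, hx⟩, act_eq ρ hρ a H ⟨x, hx⟩, h,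
    map_add, LinearMap.add_apply, Submodule.coe_add]

theorem act_mul (ρ : Representation k Z V) (hρ : ρ.IsSmooth) (a b : CompletedGroupAlgebra k Z)
    (x : V) : act ρ hρ (a * b) x = act ρ hρ a (act ρ hρ b x) := by
  obtain ⟨H, hx⟩ := exists_level ρ hρ x
  have h : (a * b).1 H = a.1 H * b.1 H := rfl
  rw [act_eq ρ hρ (a * b) H ⟨x, hx⟩, act_eq ρ hρ b H ⟨x, hx⟩, act_eq ρ hρ a H, h,
    map_mul, Module.End.mul_apply]

theorem act_algebraMap (ρ : Representation k Z V) (hρ : ρ.IsSmooth) (r : k) (x : V) :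
    act ρ hρ (algebraMap k _ r) x = r • x := by
  obtain ⟨H, hx⟩ := exists_level ρ hρ x
  have h : (algebraMap k (CompletedGroupAlgebra k Z) r).1 H = algebraMap k _ r := rfl
  rw [act_eq ρ hρ _ H ⟨x, hx⟩, h, AlgHom.commutes, Module.algebraMap_end_apply,
    Submodule.coe_smul]

/-- The action of the completed group algebra on a smooth representation of `Z`. -/
noncomputable def actionHom (ρ : Representation k Z V) (hρ : ρ.IsSmooth) :
    CompletedGroupAlgebra k Z →ₐ[k] Module.End k V where
  toFun a :=
    { toFun := act ρ hρ a
      map_add' := act_vadd ρ hρ a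
      map_smul' := act_vsmul ρ hρ a }
  map_one' := LinearMap.ext fun x => by simpa using act_algebraMap ρ hρ 1 x
  map_mul' a b := LinearMap.ext (act_mul ρ hρ a b)
  map_zero' := LinearMap.ext fun x => by simpa using act_algebraMap ρ hρ 0 x
  map_add' a b := LinearMap.ext (act_add ρ hρ a b)
  commutes' r := LinearMap.ext (act_algebraMap ρ hρ r)

end Action

section ToBernsteinCenter


theorem isSmooth_comp {k G Z V : Type*} [Field k] [Group G] [TopologicalSpace G] [Group Z]
    [TopologicalSpace Z] [AddCommGroup V] [Module k V]
    (j : Z →ₜ* G) {ρ : Representation k G V} (hρ : ρ.IsSmooth) :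
    Representation.IsSmooth (ρ.comp (j : Z →* G)) := fun x => by
  obtain ⟨H, hH, hx⟩ := hρ x
  exact ⟨H.comap (j : Z →* G), hH.preimage j.continuous_toFun, fun h hh => hx _ hh⟩

variable (k : Type u) [Field k] {G : Type v} [Group G] [TopologicalSpace G]
  {Z : Type v} [Group Z] [IsMulCommutative Z] [TopologicalSpace Z] [IsLocallyProfinite Z]

/-- For a continuous homomorphism `j : Z → G` with central image, every smooth representation of
`G` is a smooth representation of `Z` via `j`, and the resulting action of the completed group
algebra of `Z` defines an algebra homomorphism to the Bernstein center of `G`. -/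
noncomputable def toBernsteinCenter (j : Z →ₜ* G) (hj : ∀ z, j z ∈ Subgroup.center G) :
    CompletedGroupAlgebra k Z →ₐ[k] BernsteinCenter.{w} k G where
  toFun a :=
    { app := fun V => ObjectProperty.homMk (Rep.ofHom
        { toLinearMap := actionHom (V.obj.ρ.comp (j : Z →* G)) (isSmooth_comp j V.property) a
          isIntertwining' := fun g => LinearMap.ext fun x =>
            (act_intertwining (V.obj.ρ.comp (j : Z →* G)) (isSmooth_comp j V.property)
              (V.obj.ρ.comp (j : Z →* G)) (isSmooth_comp j V.property) (V.obj.ρ g) (fun z y => by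
              change V.obj.ρ g (V.obj.ρ (j z) y) = V.obj.ρ (j z) (V.obj.ρ g y)
              rw [← Module.End.mul_apply, ← Module.End.mul_apply, ← map_mul, ← map_mul,
                Subgroup.mem_center_iff.1 (hj z) g]) a x).symm })
      naturality := fun V W f => by
        ext x
        exact (act_intertwining (V.obj.ρ.comp (j : Z →* G)) (isSmooth_comp j V.property)
          (W.obj.ρ.comp (j : Z →* G)) (isSmooth_comp j W.property) f.hom.hom.toLinearMap
          (fun z y => Rep.hom_comm_apply f.hom (j z) y) a x).symm }
  map_one' := by
    ext V x
    exact LinearMap.congr_fun (map_one (actionHom (V.obj.ρ.comp (j : Z →* G)) _)) x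
  map_mul' a b := by
    ext V x
    exact LinearMap.congr_fun (map_mul (actionHom (V.obj.ρ.comp (j : Z →* G)) _) a b) x
  map_zero' := by
    ext V x
    exact LinearMap.congr_fun (map_zero (actionHom (V.obj.ρ.comp (j : Z →* G)) _)) x
  map_add' a b := by
    ext V x
    exact LinearMap.congr_fun (map_add (actionHom (V.obj.ρ.comp (j : Z →* G)) _) a b) x
  commutes' r := by
    ext V x
    exact LinearMap.congr_fun (AlgHom.commutes (actionHom (V.obj.ρ.comp (j : Z →* G)) _) r) x

/-- The natural map `Φ_Z` from the completed group algebra of `Z` to the Bernstein center of `Z`,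
for a commutative locally profinite group `Z`. -/
noncomputable def phiComm (Z : Type v) [Group Z] [IsMulCommutative Z] [TopologicalSpace Z] [IsLocallyProfinite Z] :
    CompletedGroupAlgebra k Z →ₐ[k] BernsteinCenter.{w} k Z :=
  toBernsteinCenter k (ContinuousMonoidHom.id Z) (by simp [Subgroup.center_eq_top])

/-- The natural map `Φ_G` from the completed group algebra of the center `Z(G)` to the Bernstein
center of `G`, for a locally profinite group `G`. -/
noncomputable def phi (G : Type v) [Group G] [TopologicalSpace G] [IsLocallyProfinite G] :
    CompletedGroupAlgebra k (Subgroup.center G) →ₐ[k] BernsteinCenter.{w} k G :=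
  toBernsteinCenter k ⟨(Subgroup.center G).subtype, continuous_subtype_val⟩ fun z => z.2

end ToBernsteinCenter

end CompletedGroupAlgebra

/-! A vector fixed by an open subgroup `U` is the image of the generator of k[G/U] under a G-map, so
a central element z is determined by the values c_U ∈ k[G/U] it takes on these generators, with `U`
small (`onRep_eq_cosetRepLift`). The point is that c_U is supported on cosets meeting the center.
For `N` open and normal in `U`, the coefficient of c_U at xU is the sum of the coefficients of c_N
over the N-cosets in xU. These coefficients are invariant under conjugation by S = U ∩ xUx⁻¹
(`onCosets_conj`). As S lies in a pro-p group, its nontrivial finite orbits have size divisible by p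
and contribute 0 in characteristic p. A nonzero coefficient therefore forces, for every `N`, a coset
yN ⊆ xU fixed by S; compactness (`CompactOpenSubgroup.exists_commute`) gives y ∈ xU commuting with
S. Its centraliser is open, so y is central. Thus c_U comes from k[Z/(Z ∩ U)]; the c_U are
compatible and the Z ∩ U are cofinal, so they assemble to one element of the completed group algebra
(`toBernsteinCenter_surjective`). For the center itself in place of `G`, the support condition is
vacuous. `ULift` only adjusts universes. -/

/-! ### Orbit counting modulo p for pro-p groups. -/

theorem IsProP.exists_pow_mem {p : ℕ} {G : Type*} [Group G] [TopologicalSpace G]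
    {P : Subgroup G} (hP : IsProP p P) {V : Subgroup G} (hV : IsOpen (V : Set G))
    {s : G} (hs : s ∈ P) : ∃ n : ℕ, s ^ p ^ n ∈ V := by
  have := hP.toIsTopologicalGroup
  have := hP.toCompactSpace
  have := hP.toT2Space
  have := hP.toTotallyDisconnectedSpace
  obtain ⟨N, hN⟩ := ProfiniteGrp.exist_openNormalSubgroup_sub_open_nhds_of_one
    (hV.preimage (continuous_subtype_val (p := (· ∈ P)))) (by simp)
  obtain ⟨n, hn⟩ := hP.isPGroup_quotient N.toSubgroup N.isOpen' ((⟨s, hs⟩ : P) : P ⧸ N.toSubgroup)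
  rw [← QuotientGroup.mk_pow, QuotientGroup.eq_one_iff] at hn
  exact ⟨n, by simpa using hN hn⟩

/-- If every element of `S` has `p`-power order in its action on any given point, and `S` has no
fixed point in a finite `S`-stable set, then that set has cardinality divisible by `p`. -/
theorem dvd_card_of_forall_not_fixed {p : ℕ} [Fact p.Prime] {S X : Type*} [Group S] [MulAction S X]
    (hS : ∀ (s : S) (x : X), ∃ n : ℕ, s ^ p ^ n • x = x) (t : Finset X)
    (ht : ∀ (s : S), ∀ x ∈ t, s • x ∈ t) (hfix : ∀ x ∈ t, ∃ s : S, s • x ≠ x) :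
    p ∣ t.card := by
  let Y : SubMulAction S X := ⟨t, fun s x hx => ht s x hx⟩
  have : Finite Y := inferInstanceAs (Finite (t : Set X))
  have hR : IsPGroup p (MulAction.toPermHom S Y).range := by
    rw [isPGroup_iff_pow_pow_eq_one]
    rintro ⟨_, s, rfl⟩
    choose n hn using hS s
    -- The exponent depends on the point; finiteness of `t` gives one that works for all points.
    obtain ⟨N, hN⟩ := Finset.exists_le (t.image n)
    refine ⟨N, ?_⟩
    ext y
    have hy : n y ≤ N := hN _ (Finset.mem_image_of_mem n y.2)
    have h : s ^ p ^ N ∈ MulAction.stabilizer S (y : X) := by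
      obtain ⟨d, rfl⟩ := Nat.exists_eq_add_of_le hy
      rw [pow_add, pow_mul]
      exact pow_mem (MulAction.mem_stabilizer_iff.2 (hn y)) _
    rw [SubgroupClass.coe_pow, ← map_pow]
    exact h
  have hcard := hR.card_modEq_card_fixedPoints Y
  have hempty : IsEmpty (MulAction.fixedPoints (MulAction.toPermHom S Y).range Y) := by
    refine ⟨fun y => ?_⟩
    obtain ⟨s, hs⟩ := hfix y.1.1 y.1.2
    exact hs (congrArg Subtype.val (y.2 ⟨_, s, rfl⟩))
  rw [Nat.card_of_isEmpty (α := MulAction.fixedPoints (MulAction.toPermHom S Y).range Y),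
    Nat.modEq_zero_iff_dvd] at hcard
  have : Nat.card Y = t.card := Nat.card_eq_card_toFinset (t : Set X) |>.trans (by simp)
  rwa [this] at hcard

/-- Each level set of `f` in `t` is `S`-stable without fixed points, so its cardinality vanishes in
`k`. -/
theorem sum_eq_zero_of_forall_not_fixed {p : ℕ} [Fact p.Prime] {k : Type*} [Field k] [CharP k p]
    {S X : Type*} [Group S] [MulAction S X]
    (hS : ∀ (s : S) (x : X), ∃ n : ℕ, s ^ p ^ n • x = x) (t : Finset X)
    (ht : ∀ (s : S), ∀ x ∈ t, s • x ∈ t) (hfix : ∀ x ∈ t, ∃ s : S, s • x ≠ x)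
    (f : X → k) (hf : ∀ (s : S), ∀ x, f (s • x) = f x) :
    ∑ x ∈ t, f x = 0 := by
  classical
  rw [← Finset.sum_fiberwise_of_maps_to (t := t.image f) fun x => Finset.mem_image_of_mem f]
  refine Finset.sum_eq_zero fun c _ => ?_
  rw [Finset.sum_congr rfl fun x hx => (Finset.mem_filter.1 hx).2, Finset.sum_const, nsmul_eq_mul]
  have h := dvd_card_of_forall_not_fixed hS (t.filter (f · = c))
    (fun s x hx => by
      rw [Finset.mem_filter] at hx ⊢
      exact ⟨ht s x hx.1, (hf s x).trans hx.2⟩)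
    (fun x hx => hfix x (Finset.mem_filter.1 hx).1)
  rw [(CharP.cast_eq_zero_iff k p _).2 h, zero_mul]

/-! ### Conjugation on cosets, and a compactness argument. -/

/-- The conjugation action of a subgroup `S` on the cosets of a subgroup normalised by `S`. -/
abbrev conjCosetAction {G : Type v} [Group G] (S N : Subgroup G)
    (h : ∀ s ∈ S, ∀ n ∈ N, s * n * s⁻¹ ∈ N) : MulAction S (ULift.{w} (G ⧸ N)) where
  smul s q := ⟨Quotient.map' (fun y => s.1 * y * s.1⁻¹) (fun a b hab => by
    rw [QuotientGroup.leftRel_apply] at hab ⊢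
    convert h s.1 s.2 _ hab using 1
    group) q.down⟩
  one_smul := by
    rintro ⟨q⟩
    induction q using QuotientGroup.induction_on with
    | H y => exact congrArg (fun g : G => (⟨(g : G ⧸ N)⟩ : ULift.{w} (G ⧸ N))) (by simp)
  mul_smul := by
    rintro s t ⟨q⟩
    induction q using QuotientGroup.induction_on with
    | H y =>
      exact congrArg (fun g : G => (⟨(g : G ⧸ N)⟩ : ULift.{w} (G ⧸ N))) (by simp [mul_assoc])

/-- In a compact open subgroup `U` the open normal subgroups of `U` are a neighbourhood basis. -/
theorem CompactOpenSubgroup.exists_openNormalSubgroup {G : Type*} [Group G] [TopologicalSpace G]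
    [IsLocallyProfinite G] (U : CompactOpenSubgroup G) {V : Set G} (hV : IsOpen V) (h1 : 1 ∈ V) :
    ∃ N : OpenNormalSubgroup U.1, (N.toSubgroup.map U.1.subtype : Set G) ⊆ V := by
  have := isCompact_iff_compactSpace.1 U.2.2
  obtain ⟨N, hN⟩ := ProfiniteGrp.exist_openNormalSubgroup_sub_open_nhds_of_one
    (hV.preimage (continuous_subtype_val (p := (· ∈ U.1)))) (by simpa)
  refine ⟨N, ?_⟩
  rintro _ ⟨n, hn, rfl⟩
  exact hN hn

/-- If `S` commutes with some element of `x U` modulo arbitrarily small subgroups, then it commutes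
with some element of `x U`. -/
theorem CompactOpenSubgroup.exists_commute {G : Type*} [Group G] [TopologicalSpace G]
    [IsLocallyProfinite G] (U : CompactOpenSubgroup G) (x : G) (S : Set G)
    (h : ∀ N : OpenNormalSubgroup U.1, ∃ y, x⁻¹ * y ∈ U.1 ∧
      ∀ s ∈ S, y⁻¹ * (s * y * s⁻¹) ∈ N.toSubgroup.map U.1.subtype) :
    ∃ y, x⁻¹ * y ∈ U.1 ∧ ∀ s ∈ S, s * y = y * s := by
  let N' (N : OpenNormalSubgroup U.1) : Subgroup G := N.toSubgroup.map U.1.subtype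
  have hclosed (N : OpenNormalSubgroup U.1) : IsClosed (N' N : Set G) :=
    Subgroup.isClosed_of_isOpen _ (U.2.1.isOpenEmbedding_subtypeVal.isOpenMap _ N.isOpen')
  -- The solutions modulo `N`: a closed subset of the compact coset xU, shrinking with `N`.
  let A (N : OpenNormalSubgroup U.1) : Set G :=
    {y | x⁻¹ * y ∈ U.1} ∩ ⋂ s ∈ S, {y | y⁻¹ * (s * y * s⁻¹) ∈ N' N}
  have hcompact : IsCompact {y | x⁻¹ * y ∈ U.1} := by
    have := U.2.2.image (continuous_const_mul x)
    convert this using 1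
    ext y
    simp
  have hAclosed (N) : IsClosed (⋂ s ∈ S, {y | y⁻¹ * (s * y * s⁻¹) ∈ N' N}) :=
    isClosed_biInter fun s _ => (hclosed N).preimage (by fun_prop)
  have hA (N) : IsCompact (A N) := hcompact.inter_right (hAclosed N)
  have hmono {N M : OpenNormalSubgroup U.1} (hNM : N ≤ M) : A N ⊆ A M := by
    refine Set.inter_subset_inter_right _ (Set.iInter₂_mono fun s _ y hy => ?_)
    exact Subgroup.map_mono (f := U.1.subtype) (show N.toSubgroup ≤ M.toSubgroup from hNM) hy
  have : Nonempty (OpenNormalSubgroup U.1) :=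
    ⟨(U.exists_openNormalSubgroup isOpen_univ trivial).choose⟩
  obtain ⟨y, hy⟩ := IsCompact.nonempty_iInter_of_directed_nonempty_isCompact_isClosed A
    (fun N M => ⟨N ⊓ M, hmono inf_le_left, hmono inf_le_right⟩)
    (fun N => by
      obtain ⟨y, hy, hyS⟩ := h N
      exact ⟨y, hy, Set.mem_iInter₂.2 hyS⟩)
    hA (fun N => (hA N).isClosed)
  rw [Set.mem_iInter] at hy
  refine ⟨y, (hy (Classical.arbitrary _)).1, fun s hs => ?_⟩
  by_contra hne
  have hne' : y⁻¹ * (s * y * s⁻¹) ≠ 1 := fun h1 => hne (by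
    rw [inv_mul_eq_one, eq_mul_inv_iff_mul_eq] at h1
    exact h1.symm)
  -- A nontrivial commutator is avoided by some open normal `N`, since points are closed.
  obtain ⟨N, hN⟩ := U.exists_openNormalSubgroup (isOpen_compl_singleton (x := y⁻¹ * (s * y * s⁻¹)))
    (by simpa using hne'.symm)
  exact hN (Set.mem_iInter₂.1 (hy N).2 s hs) rfl

/-! ### The representations k[G/U] and their universal property. -/

section CosetRepresentation

variable (k : Type u) [Field k] {G : Type v} [Group G]

/-- The permutation representation of `G` on `k[G/U]`. -/
noncomputable def cosetRep (U : Subgroup G) :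
    Representation k G (ULift.{w} (G ⧸ U) →₀ k) where
  toFun g := Finsupp.lmapDomain k k fun q => ⟨g • q.down⟩
  map_one' := by ext; simp
  map_mul' g h := by ext; simp [mul_smul]

@[simp]
theorem cosetRep_single (U : Subgroup G) (g : G) (q : ULift.{w} (G ⧸ U)) (r : k) :
    cosetRep k U g (Finsupp.single q r) = Finsupp.single ⟨g • q.down⟩ r :=
  Finsupp.mapDomain_single

/-- The basis vector gU is fixed by the open subgroup gUg⁻¹, and finite intersections handle sums.
-/
theorem cosetRep_isSmooth [TopologicalSpace G] [IsTopologicalGroup G] {U : Subgroup G}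
    (hU : IsOpen (U : Set G)) : (cosetRep.{w} k U).IsSmooth := fun f => by
  induction f using Finsupp.induction_linear with
  | zero => exact ⟨⊤, isOpen_univ, by simp⟩
  | add f f' hf hf' =>
    obtain ⟨H, hH, hfH⟩ := hf
    obtain ⟨H', hH', hfH'⟩ := hf'
    exact ⟨H ⊓ H', hH.inter hH', fun h hh => by rw [map_add, hfH h hh.1, hfH' h hh.2]⟩
  | single q r =>
    obtain ⟨q⟩ := q
    induction q using QuotientGroup.induction_on with
    | H g =>
      refine ⟨U.comap (MulAut.conj g⁻¹).toMonoidHom, hU.preimage (f := fun h => g⁻¹ * h * g⁻¹⁻¹)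
        (by fun_prop), fun h hh => ?_⟩
      rw [cosetRep_single]
      congr 2
      refine (QuotientGroup.eq.2 ?_).symm
      simpa [mul_assoc] using hh

/-- The canonical generator of `k[G/U]`. -/
noncomputable def cosetRepOne (U : Subgroup G) : ULift.{w} (G ⧸ U) →₀ k :=
  Finsupp.single ⟨(1 : G)⟩ 1

theorem cosetRep_one_eq (U : Subgroup G) (g : G) :
    cosetRep.{w} k U g (cosetRepOne k U) = Finsupp.single ⟨(g : G ⧸ U)⟩ 1 := by
  rw [cosetRepOne, cosetRep_single]
  simp

theorem cosetRepOne_fixed {U N : Subgroup G} (h : N ≤ U) :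
    ∀ u ∈ N, cosetRep.{w} k U u (cosetRepOne k U) = cosetRepOne k U := fun u hu => by
  rw [cosetRep_one_eq, cosetRepOne]
  congr 2
  exact QuotientGroup.eq.2 (by simpa using h hu)

variable {k}
variable {V : Type*} [AddCommGroup V] [Module k V] (ρ : Representation k G V)

/-- The map `k[G/U] → V` given by a `U`-fixed vector of `V`. -/
noncomputable def cosetRepLift {U : Subgroup G} (x : V) (hx : ∀ u ∈ U, ρ u x = x) :
    (ULift.{w} (G ⧸ U) →₀ k) →ₗ[k] V :=
  Finsupp.linearCombination k fun q => Quotient.liftOn' q.down (fun g => ρ g x) fun a b hab => by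
    rw [QuotientGroup.leftRel_apply] at hab
    have := congrArg (ρ a) (hx _ hab)
    rw [← Module.End.mul_apply, ← map_mul, mul_inv_cancel_left] at this
    exact this.symm

@[simp]
theorem cosetRepLift_single {U : Subgroup G} (x : V) (hx : ∀ u ∈ U, ρ u x = x) (g : G) (r : k) :
    cosetRepLift.{w} ρ x hx (Finsupp.single ⟨(g : G ⧸ U)⟩ r) = r • ρ g x :=
  Finsupp.linearCombination_single _ _ _

theorem cosetRepLift_one {U : Subgroup G} (x : V) (hx : ∀ u ∈ U, ρ u x = x) :
    cosetRepLift.{w} ρ x hx (cosetRepOne k U) = x :=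
  (cosetRepLift_single ρ x hx 1 1).trans (by simp)

theorem cosetRepLift_comm {U : Subgroup G} (x : V) (hx : ∀ u ∈ U, ρ u x = x) (g : G)
    (f : ULift.{w} (G ⧸ U) →₀ k) :
    cosetRepLift ρ x hx (cosetRep k U g f) = ρ g (cosetRepLift ρ x hx f) := by
  induction f using Finsupp.induction_linear with
  | zero => simp
  | add f f' hf hf' => simp [hf, hf']
  | single q r =>
    obtain ⟨q⟩ := q
    induction q using QuotientGroup.induction_on with
    | H h =>
      rw [cosetRep_single, cosetRepLift_single, map_smul, ← Module.End.mul_apply, ← map_mul]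
      exact cosetRepLift_single ρ x hx (g * h) r

end CosetRepresentation

/-! ### Evaluating the Bernstein center on k[G/U]. -/

namespace BernsteinCenter

variable {k : Type u} [Field k] {G : Type v} [Group G] [TopologicalSpace G]

/-- The action of an element of the Bernstein center on a smooth representation. -/
noncomputable def onRep (z : BernsteinCenter.{w} k G) {V : Type w} [AddCommGroup V] [Module k V]
    (ρ : Representation k G V) (hρ : ρ.IsSmooth) : V →ₗ[k] V :=
  (CatCenter.app z (⟨Rep.of ρ, hρ⟩ : SmoothRep k G)).hom.hom.toLinearMap

variable {V W : Type w} [AddCommGroup V] [Module k V] [AddCommGroup W] [Module k W]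

theorem map_onRep (z : BernsteinCenter.{w} k G) (ρ : Representation k G V) (hρ : ρ.IsSmooth)
    (σ : Representation k G W) (hσ : σ.IsSmooth) (f : V →ₗ[k] W)
    (hf : ∀ g x, f (ρ g x) = σ g (f x)) (x : V) :
    f (onRep z ρ hρ x) = onRep z σ hσ (f x) := by
  let F : (⟨Rep.of ρ, hρ⟩ : SmoothRep.{w} k G) ⟶ ⟨Rep.of σ, hσ⟩ :=
    ObjectProperty.homMk (Rep.ofHom ⟨f, fun g => LinearMap.ext (hf g)⟩)
  have h := CatCenter.naturality z F
  exact (congrArg (fun φ => φ.hom.hom.toLinearMap x) h).symm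

theorem onRep_comm (z : BernsteinCenter.{w} k G) (ρ : Representation k G V) (hρ : ρ.IsSmooth)
    (g : G) (x : V) : onRep z ρ hρ (ρ g x) = ρ g (onRep z ρ hρ x) :=
  Rep.hom_comm_apply (CatCenter.app z (⟨Rep.of ρ, hρ⟩ : SmoothRep k G)).hom g x

theorem onRep_ext {z z' : BernsteinCenter.{w} k G}
    (h : ∀ (V : Type w) [AddCommGroup V] [Module k V] (ρ : Representation k G V) (hρ : ρ.IsSmooth)
      (x : V), onRep z ρ hρ x = onRep z' ρ hρ x) : z = z' := by
  ext V x
  exact h V.obj.V V.obj.ρ V.property x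

variable [IsTopologicalGroup G]

/-- The image of the canonical generator of `k[G/U]` under an element of the Bernstein center. -/
noncomputable def onCosets (z : BernsteinCenter.{max u v w} k G) {U : Subgroup G}
    (hU : IsOpen (U : Set G)) : ULift.{w} (G ⧸ U) →₀ k :=
  onRep z (cosetRep k U) (cosetRep_isSmooth k hU) (cosetRepOne k U)

/-- `k[G/U]` with its generator is universal for `U`-fixed vectors. -/
theorem onRep_eq_cosetRepLift (z : BernsteinCenter.{max u v w} k G) {U : Subgroup G}
    (hU : IsOpen (U : Set G)) {V : Type (max u v w)} [AddCommGroup V] [Module k V]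
    (ρ : Representation k G V) (hρ : ρ.IsSmooth) (x : V) (hx : ∀ u ∈ U, ρ u x = x) :
    onRep z ρ hρ x = cosetRepLift ρ x hx (onCosets.{w} z hU) := by
  rw [onCosets, map_onRep z _ _ ρ hρ _ (cosetRepLift_comm ρ x hx), cosetRepLift_one]

/-- Naturality along the projection k[G/N] → k[G/U], which carries generator to generator. -/
theorem onCosets_eq_mapDomain (z : BernsteinCenter.{max u v w} k G) {U N : Subgroup G}
    (hU : IsOpen (U : Set G)) (hN : IsOpen (N : Set G)) (h : N ≤ U) :
    onCosets.{w} z hU = Finsupp.mapDomain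
      (fun q => ⟨Subgroup.quotientMapOfLE h q.down⟩) (onCosets.{w} z hN) := by
  rw [onCosets, onRep_eq_cosetRepLift z hN _ _ _ (cosetRepOne_fixed k h)]
  change _ = Finsupp.lmapDomain k k _ _
  refine LinearMap.congr_fun (Finsupp.lhom_ext fun q r => ?_) _
  obtain ⟨q⟩ := q
  induction q using QuotientGroup.induction_on with
  | H g =>
    rw [cosetRepLift_single, cosetRep_one_eq]
    simp

/-- Since `s` normalises `N`, the basis vector sN is again `N`-fixed. Computing its image under `z`
in two ways gives the left translate by `s` (as `z` commutes with `G`) and the right translate by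
`s` (by universality) of the same element; compare the coefficients at syN. -/
theorem onCosets_conj (z : BernsteinCenter.{max u v w} k G) {N : Subgroup G}
    (hN : IsOpen (N : Set G)) {s : G} (hs : ∀ n ∈ N, s * n * s⁻¹ ∈ N)
    (hs' : ∀ n ∈ N, s⁻¹ * n * s ∈ N) (y : G) :
    onCosets.{w} z hN ⟨(s * y * s⁻¹ : G)⟩ = onCosets.{w} z hN ⟨(y : G)⟩ := by
  let x : ULift.{w} (G ⧸ N) →₀ k := cosetRep k N s (cosetRepOne k N)
  have hx : ∀ u ∈ N, cosetRep.{w} k N u x = x := fun u hu => by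
    simp only [x, cosetRep_one_eq, cosetRep_single]
    congr 2
    refine (QuotientGroup.eq.2 ?_).symm
    simpa [mul_assoc] using hs' u hu
  have h1 := onRep_eq_cosetRepLift z hN _ (cosetRep_isSmooth k hN) x hx
  rw [onRep_comm] at h1
  change cosetRep k N s (onCosets z hN) = _ at h1
  have hl (f : ULift.{w} (G ⧸ N) →₀ k) (y : G) :
      cosetRep k N s f ⟨(s * y : G)⟩ = f ⟨(y : G)⟩ := by
    refine Finsupp.mapDomain_apply
      (f := fun q : ULift.{w} (G ⧸ N) => (⟨s • q.down⟩ : ULift.{w} (G ⧸ N))) ?_ f ⟨(y : G)⟩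
    rintro ⟨a⟩ ⟨b⟩ hab
    simpa using hab
  have hr (f : ULift.{w} (G ⧸ N) →₀ k) (y : G) :
      cosetRepLift _ x hx f ⟨(y * s : G)⟩ = f ⟨(y : G)⟩ := by
    induction f using Finsupp.induction_linear with
    | zero => simp
    | add f f' hf hf' => simp [hf, hf']
    | single q r =>
      obtain ⟨q⟩ := q
      induction q using QuotientGroup.induction_on with
      | H g =>
        classical
        simp only [x, cosetRepLift_single, cosetRep_one_eq, cosetRep_single]
        simp only [Finsupp.smul_single, Finsupp.single_apply, ULift.up.injEq, smul_eq_mul, mul_one]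
        refine if_congr ?_ rfl rfl
        rw [MulAction.Quotient.smul_coe, smul_eq_mul, QuotientGroup.eq, QuotientGroup.eq]
        refine ⟨fun h => by simpa [mul_assoc] using hs _ h, fun h => ?_⟩
        simpa [mul_assoc] using hs' _ h
  have h2 := DFunLike.congr_fun h1 ⟨(s * y : G)⟩
  rw [hl, ← inv_mul_cancel_right (s * y) s, hr] at h2
  exact h2.symm

end BernsteinCenter

/-! ### The support of a central element. -/

namespace BernsteinCenter

variable {k : Type u} [Field k] {G : Type v} [Group G] [TopologicalSpace G] [IsLocallyProfinite G]

/-- In characteristic `p`, an element of the Bernstein center sends the generator of `k[G/U]`, for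
small `U`, to an element supported on cosets that meet an open centraliser. -/
theorem exists_commute_of_onCosets_ne_zero {p : ℕ} [Fact p.Prime] [CharP k p] {P : Subgroup G}
    (hP : IsProP p P) (z : BernsteinCenter.{max u v w} k G) (U : CompactOpenSubgroup G)
    (hUP : U.1 ≤ P) (x : G) (hx : onCosets.{w} z U.2.1 ⟨(x : G)⟩ ≠ 0) :
    ∃ y, x⁻¹ * y ∈ U.1 ∧ ∀ s ∈ U.1 ⊓ U.1.comap (MulAut.conj x⁻¹).toMonoidHom, s * y = y * s := by
  classical
  -- This is U ∩ xUx⁻¹: lying in `U` makes it normalise `N`, and lying in xUx⁻¹ makes conjugation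
  -- preserve xU.
  set S := U.1 ⊓ U.1.comap (MulAut.conj x⁻¹).toMonoidHom
  have hSx (s : S) : x⁻¹ * s.1 * x ∈ U.1 := by simpa using s.2.2
  refine U.exists_commute x S fun N => ?_
  -- Otherwise, for some `N`, no `N`-coset in xU is fixed by `S`, and orbit counting kills the
  -- coefficient.
  by_contra! hcon
  refine hx ?_
  set N' : Subgroup G := N.toSubgroup.map U.1.subtype
  have hNo : IsOpen (N' : Set G) := U.2.1.isOpenEmbedding_subtypeVal.isOpenMap _ N.isOpen'
  have hNU : N' ≤ U.1 := Subgroup.map_subtype_le _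
  have hnorm : ∀ s ∈ U.1, ∀ n ∈ N', s * n * s⁻¹ ∈ N' := by
    rintro s hs _ ⟨n, hn, rfl⟩
    exact ⟨_, N.isNormal'.conj_mem n hn ⟨s, hs⟩, rfl⟩
  let act : MulAction S (ULift.{w} (G ⧸ N')) := conjCosetAction S N' fun s hs => hnorm s hs.1
  set c := onCosets.{w} z hNo
  have hc (s : S) (q : ULift.{w} (G ⧸ N')) : c (act.toSMul.smul s q) = c q := by
    obtain ⟨q⟩ := q
    induction q using QuotientGroup.induction_on with
    | H y =>
      exact onCosets_conj z hNo (hnorm s s.2.1)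
        (fun n hn => by simpa using hnorm _ (inv_mem s.2.1) n hn) y
  let t := c.support.filter fun q => Subgroup.quotientMapOfLE hNU q.down = (x : G ⧸ U.1)
  have hsum : onCosets.{w} z U.2.1 ⟨(x : G)⟩ = ∑ q ∈ t, c q := by
    rw [onCosets_eq_mapDomain z U.2.1 hNo hNU, Finsupp.mapDomain, Finsupp.sum_apply, Finsupp.sum,
      Finset.sum_filter]
    exact Finset.sum_congr rfl fun q _ => by simp [Finsupp.single_apply, c]
  rw [hsum]
  refine sum_eq_zero_of_forall_not_fixed (p := p) (S := S) ?_ t ?_ ?_ c hc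
  · rintro s ⟨q⟩
    induction q using QuotientGroup.induction_on with
    | H y =>
      -- Conjugation by an element of N' ∩ yN'y⁻¹ fixes the coset yN', and some p-power of `s` lies
      -- in this open subgroup.
      have hW : IsOpen ((N' ⊓ N'.comap (MulAut.conj y⁻¹).toMonoidHom : Subgroup G) : Set G) :=
        hNo.inter (hNo.preimage (f := fun h => y⁻¹ * h * y⁻¹⁻¹) (by fun_prop))
      obtain ⟨n, hn, hn'⟩ := hP.exists_pow_mem hW (hUP s.2.1)
      refine ⟨n, congrArg ULift.up (QuotientGroup.eq.2 ?_).symm⟩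
      have h1 : y⁻¹ * s.1 ^ p ^ n * y ∈ N' := by simpa using hn'
      simpa [mul_assoc] using mul_mem h1 (inv_mem hn)
  · rintro s ⟨q⟩ hq
    rw [Finset.mem_filter, Finsupp.mem_support_iff] at hq ⊢
    refine ⟨fun h => hq.1 ((hc s _).symm.trans h), ?_⟩
    obtain ⟨-, hq⟩ := hq
    induction q using QuotientGroup.induction_on with
    | H y =>
      have hy : x⁻¹ * y ∈ U.1 := QuotientGroup.eq.1 hq.symm
      refine (QuotientGroup.eq.2 ?_).symm
      simpa [mul_assoc] using mul_mem (mul_mem (hSx s) hy) (inv_mem s.2.1)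
  · rintro ⟨q⟩ hq
    obtain ⟨-, hq⟩ := Finset.mem_filter.1 hq
    induction q using QuotientGroup.induction_on with
    | H y =>
      obtain ⟨s, hs, hsy⟩ := hcon y (QuotientGroup.eq.1 hq.symm)
      refine ⟨⟨s, hs⟩, fun h => hsy ?_⟩
      exact QuotientGroup.eq.1 (congrArg ULift.down h).symm

/-- The element `y` commutes with the open subgroup U ∩ xUx⁻¹, so its centraliser is open and hence
all of `G`. -/
theorem mem_center_of_onCosets_ne_zero {p : ℕ} [Fact p.Prime] [CharP k p] {P : Subgroup G}
    (hP : IsProP p P) (hG : NoProperOpenCentralizer G) (z : BernsteinCenter.{max u v w} k G)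
    (U : CompactOpenSubgroup G) (hUP : U.1 ≤ P) (x : G)
    (hx : onCosets.{w} z U.2.1 ⟨(x : G)⟩ ≠ 0) :
    ∃ y ∈ Subgroup.center G, x⁻¹ * y ∈ U.1 := by
  obtain ⟨y, hy, hyS⟩ := exists_commute_of_onCosets_ne_zero hP z U hUP x hx
  refine ⟨y, ?_, hy⟩
  have hS : IsOpen ((U.1 ⊓ U.1.comap (MulAut.conj x⁻¹).toMonoidHom : Subgroup G) : Set G) :=
    U.2.1.inter (U.2.1.preimage (f := fun h => x⁻¹ * h * x⁻¹⁻¹) (by fun_prop))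
  have h := hG y (Subgroup.isOpen_mono (fun s hs => Subgroup.mem_centralizer_singleton_iff.2
    (hyS s hs)) hS)
  refine Subgroup.mem_center_iff.2 fun g => ?_
  exact Subgroup.mem_centralizer_singleton_iff.1 (h ▸ Subgroup.mem_top g)

end BernsteinCenter

/-! ### Comparison of the completed group algebra with the Bernstein center. -/

namespace CompletedGroupAlgebra

variable {k : Type u} [Field k] {G : Type v} [Group G] [TopologicalSpace G]
  {Z : Type v} [Group Z] [TopologicalSpace Z]

/-- The preimage of a compact open subgroup under a closed embedding. -/
def comapCompactOpen (j : Z →ₜ* G) (hemb : Topology.IsClosedEmbedding j)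
    (U : CompactOpenSubgroup G) : CompactOpenSubgroup Z :=
  ⟨U.1.comap (j : Z →* G), U.2.1.preimage hemb.continuous, hemb.isCompact_preimage U.2.2⟩

/-- The topology of `Z` is induced by `j`. This cofinality lets elements of the completed group
algebra be tested and built on the preimages of small `U` alone. -/
theorem exists_comapCompactOpen_le [IsLocallyProfinite G] (j : Z →ₜ* G)
    (hemb : Topology.IsClosedEmbedding j) {U₀ : Set G} (hU₀ : U₀ ∈ nhds (1 : G)) (H : CompactOpenSubgroup Z) :
    ∃ U : CompactOpenSubgroup G, (U.1 : Set G) ⊆ U₀ ∧ comapCompactOpen j hemb U ≤ H := by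
  have h1 : (H.1 : Set Z) ∈ nhds (1 : Z) := H.2.1.mem_nhds H.1.one_mem
  rw [hemb.isInducing.nhds_eq_comap, Filter.mem_comap, map_one] at h1
  obtain ⟨V, hV, hVH⟩ := h1
  obtain ⟨U, hU⟩ := IsLocallyProfinite.exists_compactOpenSubgroup (Filter.inter_mem hU₀ hV)
  exact ⟨U, fun x hx => (hU hx).1, fun x hx => hVH (hU hx).2⟩

/-- The map `Z/(Z ∩ U) → G/U`. -/
def cosetMap (j : Z →ₜ* G) (hemb : Topology.IsClosedEmbedding j) (U : CompactOpenSubgroup G)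
    (q : Z ⧸ (comapCompactOpen j hemb U).1) : ULift.{w} (G ⧸ U.1) :=
  ⟨Quotient.map' j (fun a b h => by
    rw [QuotientGroup.leftRel_apply] at h ⊢
    rw [← map_inv, ← map_mul]
    exact h) q⟩

theorem cosetMap_injective (j : Z →ₜ* G) (hemb : Topology.IsClosedEmbedding j)
    (U : CompactOpenSubgroup G) : Function.Injective (cosetMap.{w} j hemb U) := fun a b hab => by
  induction a using QuotientGroup.induction_on with
  | H a =>
    induction b using QuotientGroup.induction_on with
    | H b =>
      have h : (j a)⁻¹ * j b ∈ U.1 := QuotientGroup.eq.1 (congrArg ULift.down hab)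
      rw [← map_inv, ← map_mul] at h
      exact QuotientGroup.eq.2 h

/-- The map `k[Z/(Z ∩ U)] → k[G/U]`. -/
noncomputable def toCosets (j : Z →ₜ* G) (hemb : Topology.IsClosedEmbedding j)
    (U : CompactOpenSubgroup G) (b : MonoidAlgebra k (Z ⧸ (comapCompactOpen j hemb U).1)) :
    ULift.{w} (G ⧸ U.1) →₀ k :=
  Finsupp.mapDomain (cosetMap.{w} j hemb U) b.coeff

theorem toCosets_injective (j : Z →ₜ* G) (hemb : Topology.IsClosedEmbedding j)
    (U : CompactOpenSubgroup G) : Function.Injective (toCosets.{w} (k := k) j hemb U) :=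
  (Finsupp.mapDomain_injective (cosetMap_injective j hemb U)).comp MonoidAlgebra.coeff_injective

variable [IsMulCommutative Z]

theorem toCosets_transition (j : Z →ₜ* G) (hemb : Topology.IsClosedEmbedding j)
    {N U : CompactOpenSubgroup G} (h : N.1 ≤ U.1)
    (h' : (comapCompactOpen j hemb N).1 ≤ (comapCompactOpen j hemb U).1)
    (b : MonoidAlgebra k (Z ⧸ (comapCompactOpen j hemb N).1)) :
    toCosets.{w} j hemb U (groupAlgebraTransition k h' b) =
      Finsupp.mapDomain (fun q => ⟨Subgroup.quotientMapOfLE h q.down⟩) (toCosets.{w} j hemb N b) := by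
  rw [toCosets, toCosets, ← Finsupp.mapDomain_comp]
  simp only [groupAlgebraTransition, MonoidAlgebra.mapDomainAlgHom_apply,
    MonoidAlgebra.coeff_mapDomain]
  rw [← Finsupp.mapDomain_comp]
  congr 1
  ext q
  induction q using QuotientGroup.induction_on with
  | H z => rfl

variable [IsLocallyProfinite Z]

/-- The generator is fixed by the preimage of `U`, so the component of `a` at that level computes
the action. -/
theorem act_cosetRepOne (j : Z →ₜ* G) (hemb : Topology.IsClosedEmbedding j)
    (U : CompactOpenSubgroup G)
    (hU : Representation.IsSmooth ((cosetRep.{w} k U.1).comp (j : Z →* G)))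
    (a : CompletedGroupAlgebra k Z) :
    act ((cosetRep.{w} k U.1).comp (j : Z →* G)) hU a (cosetRepOne k U.1) =
      toCosets.{w} j hemb U (a.1 (comapCompactOpen j hemb U)) := by
  have hx : cosetRepOne.{w} k U.1 ∈ Representation.invariants
      (((cosetRep.{w} k U.1).comp (j : Z →* G)).comp (comapCompactOpen j hemb U).1.subtype) :=
    fun h => cosetRepOne_fixed k le_rfl (j h) h.2
  refine (act_eq _ hU a (comapCompactOpen j hemb U) ⟨_, hx⟩).trans ?_
  generalize a.1 (comapCompactOpen j hemb U) = b
  induction b using MonoidAlgebra.induction_linear with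
  | zero => simp [toCosets]
  | add b b' hb hb' => simpa [toCosets, Finsupp.mapDomain_add] using congrArg₂ (· + ·) hb hb'
  | single q r =>
    induction q using QuotientGroup.induction_on with
    | H z =>
      simp only [levelAction, toCosets, Representation.asAlgebraHom_single, LinearMap.smul_apply,
        Submodule.coe_smul, MonoidAlgebra.coeff_single, Finsupp.mapDomain_single]
      change r • cosetRep k U.1 (j z) (cosetRepOne k U.1) = _
      rw [cosetRep_one_eq, Finsupp.smul_single, smul_eq_mul, mul_one]
      rfl

variable [IsLocallyProfinite G]

theorem onCosets_toBernsteinCenter (j : Z →ₜ* G) (hj : ∀ z, j z ∈ Subgroup.center G)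
    (hemb : Topology.IsClosedEmbedding j) (a : CompletedGroupAlgebra k Z)
    (U : CompactOpenSubgroup G) :
    BernsteinCenter.onCosets.{w} (toBernsteinCenter.{max u v w} k j hj a) U.2.1 =
      toCosets.{w} j hemb U (a.1 (comapCompactOpen j hemb U)) :=
  act_cosetRepOne j hemb U (isSmooth_comp j (cosetRep_isSmooth k U.2.1)) a

/-- The value on the generator of k[G/U] recovers the component at the preimage of `U`, and these
levels are cofinal. -/
theorem toBernsteinCenter_injective (j : Z →ₜ* G) (hj : ∀ z, j z ∈ Subgroup.center G)
    (hemb : Topology.IsClosedEmbedding j) :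
    Function.Injective (toBernsteinCenter.{max u v w} k j hj) := fun a b hab => by
  refine Subtype.ext (funext fun H => ?_)
  obtain ⟨U, -, hU⟩ := exists_comapCompactOpen_le j hemb Filter.univ_mem H
  have h : a.1 (comapCompactOpen j hemb U) = b.1 (comapCompactOpen j hemb U) :=
    toCosets_injective.{w} j hemb U (by
      rw [← onCosets_toBernsteinCenter j hj, ← onCosets_toBernsteinCenter j hj, hab])
  rw [← a.2 _ H hU, ← b.2 _ H hU, h]

/-- If every element of the Bernstein center sends the generators of `k[G/U]`, for small `U`, to
elements supported on the image of `Z`, then the Bernstein center comes from the completed group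
algebra of `Z`. -/
theorem toBernsteinCenter_surjective (j : Z →ₜ* G) (hj : ∀ z, j z ∈ Subgroup.center G)
    (hemb : Topology.IsClosedEmbedding j) {U₀ : Set G} (hU₀ : U₀ ∈ nhds (1 : G))
    (hsupp : ∀ (z : BernsteinCenter.{max u v w} k G) (U : CompactOpenSubgroup G),
      (U.1 : Set G) ⊆ U₀ → ∀ x : G, BernsteinCenter.onCosets.{w} z U.2.1 ⟨(x : G)⟩ ≠ 0 →
        ∃ y : Z, x⁻¹ * j y ∈ U.1) :
    Function.Surjective (toBernsteinCenter.{max u v w} k j hj) := fun z => by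
  have hb (U : CompactOpenSubgroup G) (hU : (U.1 : Set G) ⊆ U₀) :
      ∃ b, toCosets.{w} j hemb U b = BernsteinCenter.onCosets.{w} z U.2.1 := by
    refine ⟨.ofCoeff ((BernsteinCenter.onCosets.{w} z U.2.1).comapDomain (cosetMap.{w} j hemb U)
      (cosetMap_injective j hemb U).injOn), ?_⟩
    refine Finsupp.mapDomain_comapDomain _ (cosetMap_injective j hemb U) _ ?_
    rintro ⟨q⟩ hq
    induction q using QuotientGroup.induction_on with
    | H x =>
      obtain ⟨y, hy⟩ := hsupp z U hU x (Finsupp.mem_support_iff.1 hq)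
      exact ⟨(y : Z ⧸ (comapCompactOpen j hemb U).1), (congrArg ULift.up (QuotientGroup.eq.2 hy).symm :
        (⟨(j y : G)⟩ : ULift.{w} (G ⧸ U.1)) = ⟨(x : G)⟩)⟩
  choose b hb using hb
  have hbtrans {N U : CompactOpenSubgroup G} (hN : (N.1 : Set G) ⊆ U₀) (hU : (U.1 : Set G) ⊆ U₀)
      (h : N.1 ≤ U.1) (h' : (comapCompactOpen j hemb N).1 ≤ (comapCompactOpen j hemb U).1) :
      groupAlgebraTransition k h' (b N hN) = b U hU :=
    toCosets_injective.{w} j hemb U (by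
      rw [toCosets_transition j hemb h h', hb, hb, ← BernsteinCenter.onCosets_eq_mapDomain])
  have htrans {H K L : Subgroup Z} (h₁ : H ≤ K) (h₂ : K ≤ L) (c : MonoidAlgebra k (Z ⧸ H)) :
      groupAlgebraTransition k h₂ (groupAlgebraTransition k h₁ c) =
        groupAlgebraTransition k (h₁.trans h₂) c := by
    induction c using MonoidAlgebra.induction_linear with
    | zero => simp
    | add c c' hc hc' => simp [hc, hc']
    | single q r =>
      induction q using QuotientGroup.induction_on with
      | H y =>
        simp only [groupAlgebraTransition, MonoidAlgebra.mapDomainAlgHom_apply,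
          MonoidAlgebra.mapDomain_single]
        rfl
  have hindep {N U : CompactOpenSubgroup G} (hN : (N.1 : Set G) ⊆ U₀) (hU : (U.1 : Set G) ⊆ U₀)
      {H : Subgroup Z} (hNH : (comapCompactOpen j hemb N).1 ≤ H)
      (hUH : (comapCompactOpen j hemb U).1 ≤ H) :
      groupAlgebraTransition k hNH (b N hN) = groupAlgebraTransition k hUH (b U hU) := by
    -- Both sides are images of the element at the common refinement N ∩ U.
    let M : CompactOpenSubgroup G :=
      ⟨N.1 ⊓ U.1, N.2.1.inter U.2.1, N.2.2.inter_right (Subgroup.isClosed_of_isOpen _ U.2.1)⟩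
    have hM : (M.1 : Set G) ⊆ U₀ := fun x hx => hN hx.1
    have h₁ : (comapCompactOpen j hemb M).1 ≤ (comapCompactOpen j hemb N).1 :=
      Subgroup.comap_mono inf_le_left
    have h₂ : (comapCompactOpen j hemb M).1 ≤ (comapCompactOpen j hemb U).1 :=
      Subgroup.comap_mono inf_le_right
    rw [← hbtrans hM hN inf_le_left h₁, ← hbtrans hM hU inf_le_right h₂, htrans, htrans]
  choose W hW hWH using exists_comapCompactOpen_le j hemb hU₀
  let a : CompletedGroupAlgebra k Z :=
    ⟨fun H => groupAlgebraTransition k (hWH H) (b (W H) (hW H)), fun H K h => by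
      rw [htrans]
      exact hindep _ _ _ _⟩
  -- The subgroup `W` chosen for the preimage of `U` need not be `U`; independence of the choice
  -- closes the gap.
  have ha (U : CompactOpenSubgroup G) (hU : (U.1 : Set G) ⊆ U₀) :
      a.1 (comapCompactOpen j hemb U) = b U hU := by
    rw [← hbtrans hU hU le_rfl le_rfl]
    exact hindep _ _ _ _
  refine ⟨a, BernsteinCenter.onRep_ext fun V _ _ ρ hρ x => ?_⟩
  obtain ⟨O, hO, hx⟩ := hρ x
  obtain ⟨U, hU⟩ := IsLocallyProfinite.exists_compactOpenSubgroup
    (Filter.inter_mem hU₀ (hO.mem_nhds O.one_mem))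
  have hxU : ∀ u ∈ U.1, ρ u x = x := fun u hu => hx u (hU hu).2
  rw [BernsteinCenter.onRep_eq_cosetRepLift.{w} _ U.2.1 ρ hρ x hxU,
    BernsteinCenter.onRep_eq_cosetRepLift.{w} _ U.2.1 ρ hρ x hxU,
    onCosets_toBernsteinCenter j hj hemb, ha U fun u hu => (hU hu).1]
  exact congrArg _ (hb U _)

/-! ### Bijectivity of the two natural maps. -/

theorem phiComm_bijective (Z : Type v) [Group Z] [IsMulCommutative Z] [TopologicalSpace Z]
    [IsLocallyProfinite Z] : Function.Bijective (phiComm.{max u v w} k Z) :=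
  have hemb : Topology.IsClosedEmbedding (ContinuousMonoidHom.id Z) := .id
  ⟨toBernsteinCenter_injective.{w} _ _ hemb,
    -- With `j` the identity, every coset meets the image, so no smallness of `U` is needed.
    toBernsteinCenter_surjective.{w} _ _ hemb Filter.univ_mem fun _ U _ x _ => ⟨x, by simp⟩⟩

theorem phi_bijective {p : ℕ} [Fact p.Prime] [CharP k p] (hp : IsLocallyProP p G)
    (hG : NoProperOpenCentralizer G) : Function.Bijective (phi.{max u v w} k G) := by
  obtain ⟨P, hPo, hP⟩ := hp
  have hc : IsClosed (Subgroup.center G : Set G) := by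
    have : (Subgroup.center G : Set G) = ⋂ g : G, {z | g * z = z * g} := by
      ext z; simp [Subgroup.mem_center_iff]
    rw [this]
    exact isClosed_iInter fun g => isClosed_eq (by fun_prop) (by fun_prop)
  have hemb : Topology.IsClosedEmbedding
      (⟨(Subgroup.center G).subtype, continuous_subtype_val⟩ : Subgroup.center G →ₜ* G) :=
    hc.isClosedEmbedding_subtypeVal
  refine ⟨toBernsteinCenter_injective.{w} _ _ hemb,
    -- Here "small" means contained in the open pro-p subgroup `P`.
    toBernsteinCenter_surjective.{w} _ _ hemb (hPo.mem_nhds P.one_mem) fun z U hU x hx => ?_⟩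
  obtain ⟨y, hy, hxy⟩ := BernsteinCenter.mem_center_of_onCosets_ne_zero hP hG z U hU x hx
  exact ⟨⟨y, hy⟩, hxy⟩

end CompletedGroupAlgebra

theorem mainTheorem2 (p : ℕ) [Fact p.Prime] (k : Type u) [Field k] [CharP k p]
    (G : Type v) [Group G] [TopologicalSpace G] [IsLocallyProfinite G]
    (hp : IsLocallyProP p G) (hG : NoProperOpenCentralizer G) :
    ∃ e : CompletedGroupAlgebra k (Subgroup.center G) ≃ₐ[k]
        BernsteinCenter.{max u v w} k (Subgroup.center G),
      e.toAlgHom = CompletedGroupAlgebra.phiComm.{max u v w} k (Subgroup.center G) ∧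
      Function.Bijective
        ((CompletedGroupAlgebra.phi.{max u v w} k G).comp e.symm.toAlgHom) := by
  refine ⟨AlgEquiv.ofBijective _ (CompletedGroupAlgebra.phiComm_bijective.{w} _), ?_, ?_⟩
  · ext; rfl
  · exact (CompletedGroupAlgebra.phi_bijective.{w} hp hG).comp (AlgEquiv.bijective _)
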